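/- **Setting.** Let $A$ be an associative unital algebra over a commutative ring $\Bbbk$ and let $(\Omega^\bullet,\wedge,d)$ be an exterior algebra over $A$: an $\mathbb N$-graded associative $\Bbbk$-algebra with $\Omega^0=A$ and a $\Bbbk$-linear differential $d$ of degree $1$ with $d^2=0$ and the graded Leibniz rule, such that $\Omega^n$ is spanned by the products $a_0\,da_1\wedge\cdots\wedge da_n$. For a left $A$-module $M$ write $\Omega^kM=\Omega^k\otimes_AM$ and $J^1M=(A\otimes_{\Bbbk} A)/N\otimes_A M$, where $N=\{\sum a_i\otimes b_i:\sum a_ib_i=0,\ \sum a_i\,db_i=0\}$, with $j^1(m)=[1\otimes 1]\otimes m$, $\pi([a\otimes b]\otimes m)=abm$ and $\iota^1(a\,db\otimes m)=[a\otimes b-ab\otimes 1]\otimes m$. Let $E$ be a left $A$-module. * *Symmetric forms:* $S^0E=E$, $S^1E=\Omega^1E$, and for $k\ge 2$, $S^kE$ is the kernel of $\Omega^1S^{k-1}E\to\Omega^1\Omega^1S^{k-2}E\xrightarrow{\wedge}\Omega^2S^{k-2}E$. Let $\iota_\wedge^{k+1}:S^{k+1}E\hookrightarrow\Omega^1S^kE$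 be the inclusion ($\iota_\wedge^1=\mathrm{id}$). * *Holonomic jets:* $J^0E=E$, $J^1E$ is as above, and for $n\ge2$, $J^nE$ is the set of elements of $J^1J^{n-1}E$ whose image in $J^1J^1J^{n-2}E$ is killed by both maps $[a\otimes b]\otimes[c\otimes m]\mapsto a\,d(bc)\otimes m\in\Omega^1J^{n-2}E$ and $[a\otimes b]\otimes[c\otimes m]\mapsto da\wedge d(bc)\otimes m\in\Omega^2J^{n-2}E$. Let $\pi^{n,n-1}:J^nE\to J^{n-1}E$ be induced by $\pi$, and let $j^n:E\to J^nE$ and $\iota^n:S^nE\to J^nE$ be the maps induced recursively by $j^1$ and $\iota^1$, with $j^0=\iota^0=\mathrm{id}_E$. * The *elemental jets* are the $A$-submodule $\check J^nE=A\,j^n(E)\subseteq J^nE$. The *$n$-jet sequence at $E$ is right exact* if $S^nE\xrightarrow{\iota^n}J^nE\xrightarrow{\pi^{n,n-1}}J^{n-1}E\to0$ is exact (with $J^{-1}E=0$). * For a left $A$-module $F$, $\mathrm{Diff}^n(E,F)$ is the $\Bbbk$-module of maps $\widetilde\Delta\circ j^n$ with $\widetilde\Delta:J^nE\to F$ $A$-linear;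 $\mathrm{Diff}^{-1}=0$, $\mathrm{Diff}=\bigcup_n\mathrm{Diff}^n$, $\mathrm{Symb}^n(E,F)=\mathrm{Diff}^n(E,F)/\mathrm{Diff}^{n-1}(E,F)$ with quotient map $\varsigma^n$, and $\mathrm{Symb}^\bullet=\bigoplus_n\mathrm{Symb}^n$. If $J^nE=\check J^nE$, the *restriction symbol* $r^n:\mathrm{Symb}^n(E,F)\to{}_A\mathrm{Hom}(S^nE,F)$ is the well-defined map $\varsigma^n(\widetilde\Delta\circ j^n)\mapsto\widetilde\Delta\circ\iota^n$. * A *natural $n$-quantization* for $E$ is a natural transformation $q^n:\mathrm{Symb}^n(E,-)\to\mathrm{Diff}^n(E,-)$ of functors from left $A$-modules to $\Bbbk$-modules with $\varsigma^n\circ q^n=\mathrm{id}$. A *natural full quantization* for $E$ is the natural transformation $q=\sum_nq^n:\mathrm{Symb}^\bullet(E,-)\to\mathrm{Diff}(E,-)$ given by a collection of natural $n$-quantizations $q^n$, $n\in\mathbb N$. * A *connection* on a left $A$-module $M$ is a $\Bbbk$-linear map $\nabla:M\to\Omega^1M$ with $\nabla(am)=da\otimes m+a\nabla m$. **Corollary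 5.11 (Full quantization).** 1. Let $n\ge 0$. Suppose that $J^nE=\check J^nE$, that the $n$-jet sequence at $E$ is right exact, and that for all $0\le k<n$ we are given a connection $\nabla^{S^kE}$ on $S^kE$ and an $A$-linear retraction $s^{1,k}:\Omega^1S^kE\to S^{k+1}E$ of $\iota_\wedge^{k+1}$ (so $s^{1,0}=\mathrm{id}$). Then there is a natural $n$-quantization $q^n$ for $E$ such that, for every left $A$-module $F$ and every $\sigma\in\mathrm{Symb}^n(E,F)$, $$q^n(\sigma)=r^n(\sigma)\circ s^{1,n-1}\circ\nabla^{S^{n-1}E}\circ s^{1,n-2}\circ\nabla^{S^{n-2}E}\circ\cdots\circ s^{1,1}\circ\nabla^{S^1E}\circ\nabla^E$$ (for $n=0$ this reads $q^0(\sigma)=r^0(\sigma)$). 2. Suppose that for all $n\ge0$ we have $J^nE=\check J^nE$ and the $n$-jet sequence at $E$ is right exact, and that for all $n\ge 0$ we are given a connection $\nabla^{S^nE}$ on $S^nE$ and an $A$-linear retraction $s^{1,n}$ of $\iota_\wedge^{n+1}$. Then there is a natural full quantization $q=\sum_nq^n$ for $E$, whose components $q^n$ are given by the formula in part 1. -/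

import Mathlib

universe u v w

set_option linter.unusedSectionVars false

open scoped TensorProduct DirectSum

namespace NCJet

/-- An exterior algebra `(Ω, ∧, d)` over the associative unital `𝕜`-algebra `A`: an associative
`ℕ`-graded `𝕜`-algebra whose degree zero part is `A`, with a `𝕜`-linear differential `d` of
degree one that squares to zero and satisfies the graded Leibniz rule, such that every form is a
sum of products `a₀ da₁ ∧ ⋯ ∧ daₙ`. -/
structure ExteriorCalculus (𝕜 : Type w) (A Ω : Type u) [CommRing 𝕜] [Ring A] [Algebra 𝕜 A]
    [Ring Ω] [Algebra 𝕜 Ω] where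
  /-- the module of forms of degree `n` -/
  deg : ℕ → Submodule 𝕜 Ω
  graded : SetLike.GradedMonoid deg
  internal : DirectSum.IsInternal deg
  /-- the identification of `A` with the forms of degree zero -/
  incl : A →ₐ[𝕜] Ω
  incl_injective : Function.Injective incl
  range_incl : LinearMap.range incl.toLinearMap = deg 0
  /-- the differential -/
  d : Ω →ₗ[𝕜] Ω
  d_mem : ∀ {n : ℕ} {ω : Ω}, ω ∈ deg n → d ω ∈ deg (n + 1)
  d_d : ∀ ω : Ω, d (d ω) = 0
  leibniz : ∀ {n : ℕ} {ω : Ω}, ω ∈ deg n → ∀ η : Ω, d (ω * η) = d ω * η + (-1) ^ n * (ω * d η)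
  surjectivity : ∀ n : ℕ,
    deg (n + 1) ≤ Submodule.span 𝕜 {x | ∃ ω ∈ deg n, ∃ a : A, x = ω * d (incl a)}

section

variable {𝕜 : Type w} {A Ω : Type u} [CommRing 𝕜] [Ring A] [Algebra 𝕜 A] [Ring Ω] [Algebra 𝕜 Ω]
variable (C : ExteriorCalculus 𝕜 A Ω)

/-! ### The bimodules of forms -/

theorem ExteriorCalculus.incl_mem (a : A) : C.incl a ∈ C.deg 0 := by
  rw [← C.range_incl]; exact ⟨a, rfl⟩

theorem ExteriorCalculus.mul_mem {m n : ℕ} {x y : Ω} (hx : x ∈ C.deg m) (hy : y ∈ C.deg n) :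
    x * y ∈ C.deg (m + n) :=
  C.graded.mul_mem hx hy

theorem ExteriorCalculus.d_incl_mul (a b : A) :
    C.d (C.incl (a * b)) = C.d (C.incl a) * C.incl b + C.incl a * C.d (C.incl b) := by
  rw [map_mul, C.leibniz (C.incl_mem a)]; simp

/-- The module `Ωᵏ` of `k`-forms. -/
def Forms (k : ℕ) : Type u := ↥(C.deg k)

instance (k : ℕ) : AddCommGroup (Forms C k) := inferInstanceAs (AddCommGroup ↥(C.deg k))

instance (k : ℕ) : Module 𝕜 (Forms C k) := inferInstanceAs (Module 𝕜 ↥(C.deg k))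

variable {C} in
/-- The underlying element of the exterior algebra. -/
def Forms.val {k : ℕ} (ω : Forms C k) : Ω := Subtype.val (p := fun x => x ∈ C.deg k) ω

variable {C} in
/-- A homogeneous element, as a form. -/
def Forms.mk {k : ℕ} (x : Ω) (hx : x ∈ C.deg k) : Forms C k := (⟨x, hx⟩ : ↥(C.deg k))

variable {C} in
@[ext] theorem Forms.ext {k : ℕ} {ω η : Forms C k} (h : ω.val = η.val) : ω = η := Subtype.ext h

variable {C} in
theorem Forms.val_mem {k : ℕ} (ω : Forms C k) : ω.val ∈ C.deg k :=
  Subtype.property (p := fun x => x ∈ C.deg k) ω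

@[simp] theorem Forms.val_mk {k : ℕ} (x : Ω) (hx : x ∈ C.deg k) :
    (Forms.mk x hx : Forms C k).val = x := rfl

@[simp] theorem Forms.val_add {k : ℕ} (ω η : Forms C k) : (ω + η).val = ω.val + η.val := rfl

@[simp] theorem Forms.val_zero {k : ℕ} : (0 : Forms C k).val = 0 := rfl

@[simp] theorem Forms.val_smul {k : ℕ} (c : 𝕜) (ω : Forms C k) : (c • ω).val = c • ω.val := rfl

/-- The left action of `A` on forms is multiplication in the exterior algebra. -/
instance (k : ℕ) : SMul A (Forms C k) :=
  ⟨fun a ω => Forms.mk (C.incl a * ω.val)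
    (by simpa using C.mul_mem (C.incl_mem a) ω.val_mem)⟩

@[simp] theorem Forms.val_left_smul {k : ℕ} (a : A) (ω : Forms C k) :
    (a • ω).val = C.incl a * ω.val := rfl

instance (k : ℕ) : Module A (Forms C k) where
  one_smul ω := by ext; simp
  mul_smul a b ω := by ext; simp [mul_assoc]
  smul_zero a := by ext; simp
  smul_add a ω η := by ext; simp [mul_add]
  add_smul a b ω := by ext; simp [add_mul]
  zero_smul ω := by ext; simp

instance (k : ℕ) : IsScalarTower 𝕜 A (Forms C k) where
  smul_assoc c a ω := by ext; simp

/-- The right action `ω ↦ ω a` of `a : A` on forms. -/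
def rmul (k : ℕ) (a : A) : Forms C k →ₗ[A] Forms C k where
  toFun ω := Forms.mk (ω.val * C.incl a) (by simpa using C.mul_mem ω.val_mem (C.incl_mem a))
  map_add' ω η := by ext; simp [add_mul]
  map_smul' b ω := by ext; simp [mul_assoc]

/-- The differential `d : A → Ω¹`. -/
def dA : A →ₗ[𝕜] Forms C 1 where
  toFun a := Forms.mk (C.d (C.incl a)) (by simpa using C.d_mem (C.incl_mem a))
  map_add' a b := by ext; simp
  map_smul' c a := by ext; simp

/-- The wedge product of one-forms, with values in two-forms. -/
def wedge : Forms C 1 →ₗ[𝕜] Forms C 1 →ₗ[𝕜] Forms C 2 :=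
  LinearMap.mk₂ 𝕜 (fun ω η => Forms.mk (ω.val * η.val) (C.mul_mem ω.val_mem η.val_mem))
    (fun _ _ _ => by ext; simp [add_mul]) (fun _ _ _ => by ext; simp)
    (fun _ _ _ => by ext; simp [mul_add]) (fun _ _ _ => by ext; simp)

@[simp] theorem val_rmul {k : ℕ} (a : A) (ω : Forms C k) :
    (rmul C k a ω).val = ω.val * C.incl a := rfl

@[simp] theorem val_dA (a : A) : (dA C a).val = C.d (C.incl a) := rfl

@[simp] theorem val_wedge (ω η : Forms C 1) : (wedge C ω η).val = ω.val * η.val := rfl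

theorem dA_mul (a b : A) : dA C (a * b) = rmul C 1 b (dA C a) + a • dA C b := by
  ext; exact C.d_incl_mul a b

theorem dA_one : dA C 1 = 0 := by
  have h := dA_mul C 1 1
  have h1 : rmul C 1 1 (dA C 1) = dA C 1 := by ext; simp
  rw [mul_one, h1, one_smul] at h
  exact left_eq_add.mp h

/-- The map `a ⊗ b ↦ a db` from `A ⊗ A` to `Ω¹`. -/
def adb : A ⊗[𝕜] A →ₗ[𝕜] Forms C 1 :=
  TensorProduct.lift (LinearMap.mk₂ 𝕜 (fun a b => a • dA C b)
    (fun _ _ _ => by simp [add_smul]) (fun c a b => smul_assoc c a _)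
    (fun _ _ _ => by simp) (fun c a b => by rw [map_smul, smul_comm]))

@[simp] theorem adb_tmul (a b : A) : adb C (a ⊗ₜ b) = a • dA C b := rfl

theorem adb_surjective : Function.Surjective (adb C) := by
  have key : ∀ x ∈ Submodule.span 𝕜 {x | ∃ ω ∈ C.deg 0, ∃ a : A, x = ω * C.d (C.incl a)},
      ∃ t : A ⊗[𝕜] A, (adb C t).val = x := by
    intro x hx
    induction hx using Submodule.span_induction with
    | mem x h =>
      obtain ⟨ω, hω, a, rfl⟩ := h
      rw [← C.range_incl] at hω
      obtain ⟨b, rfl⟩ := hω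
      exact ⟨b ⊗ₜ a, rfl⟩
    | zero => exact ⟨0, by simp⟩
    | add x y _ _ hx hy =>
      obtain ⟨s, rfl⟩ := hx
      obtain ⟨t, rfl⟩ := hy
      exact ⟨s + t, by simp⟩
    | smul c x _ hx =>
      obtain ⟨s, rfl⟩ := hx
      exact ⟨c • s, by simp⟩
  intro ω
  obtain ⟨t, ht⟩ := key ω.val (C.surjectivity 0 ω.val_mem)
  exact ⟨t, Forms.ext ht⟩

/-! ### The functor `Ωᵏ ⊗_A -` -/

section Tensor

variable (k : ℕ) (M : Type u) [AddCommGroup M] [Module 𝕜 M] [Module A M] [IsScalarTower 𝕜 A M]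

/-- The relations `ω a ⊗ m = ω ⊗ a m`. -/
def balanced : Submodule A (Forms C k ⊗[𝕜] M) :=
  Submodule.span A {x | ∃ (ω : Forms C k) (a : A) (m : M),
    x = rmul C k a ω ⊗ₜ[𝕜] m - ω ⊗ₜ[𝕜] (a • m)}

/-- The left `A`-module `Ωᵏ ⊗_A M`. -/
def FormTensor : Type u := (Forms C k ⊗[𝕜] M) ⧸ balanced C k M

instance : AddCommGroup (FormTensor C k M) :=
  inferInstanceAs (AddCommGroup ((Forms C k ⊗[𝕜] M) ⧸ balanced C k M))

instance : Module A (FormTensor C k M) :=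
  inferInstanceAs (Module A ((Forms C k ⊗[𝕜] M) ⧸ balanced C k M))

instance : Module 𝕜 (FormTensor C k M) :=
  inferInstanceAs (Module 𝕜 ((Forms C k ⊗[𝕜] M) ⧸ balanced C k M))

instance : IsScalarTower 𝕜 A (FormTensor C k M) :=
  inferInstanceAs (IsScalarTower 𝕜 A ((Forms C k ⊗[𝕜] M) ⧸ balanced C k M))

end Tensor

section TensorMaps

variable {k : ℕ} {M : Type u} [AddCommGroup M] [Module 𝕜 M] [Module A M] [IsScalarTower 𝕜 A M]
variable {M' : Type u} [AddCommGroup M'] [Module 𝕜 M'] [Module A M'] [IsScalarTower 𝕜 A M']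
variable {P : Type*} [AddCommGroup P] [Module 𝕜 P] [Module A P] [IsScalarTower 𝕜 A P]

/-- The class `ω ⊗ m` in `Ωᵏ ⊗_A M`. -/
def ft (ω : Forms C k) (m : M) : FormTensor C k M := (balanced C k M).mkQ (ω ⊗ₜ[𝕜] m)

theorem ft_add (ω : Forms C k) (m n : M) : ft C ω (m + n) = ft C ω m + ft C ω n := by
  simp only [ft, TensorProduct.tmul_add, map_add]; rfl

theorem add_ft (ω η : Forms C k) (m : M) : ft C (ω + η) m = ft C ω m + ft C η m := by
  simp only [ft, TensorProduct.add_tmul, map_add]; rfl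

theorem ft_zero (ω : Forms C k) : ft C ω (0 : M) = 0 := by
  have h := ft_add C ω (0 : M) 0
  rw [add_zero] at h
  exact left_eq_add.mp h

theorem ft_smul (c : 𝕜) (ω : Forms C k) (m : M) : ft C ω (c • m) = c • ft C ω m := by
  unfold ft; rw [TensorProduct.tmul_smul]; rfl

theorem smul_ft (c : 𝕜) (ω : Forms C k) (m : M) : ft C (c • ω) m = c • ft C ω m := by
  unfold ft; rw [← TensorProduct.smul_tmul']; rfl

theorem left_smul_ft (a : A) (ω : Forms C k) (m : M) : ft C (a • ω) m = a • ft C ω m := by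
  unfold ft; rw [← TensorProduct.smul_tmul']; rfl

theorem rmul_ft (a : A) (ω : Forms C k) (m : M) : ft C (rmul C k a ω) m = ft C ω (a • m) := by
  exact (Submodule.Quotient.eq (balanced C k M)).mpr (Submodule.subset_span ⟨ω, a, m, rfl⟩)

/-- `ft` as a `𝕜`-bilinear map. -/
def ftHom : Forms C k →ₗ[𝕜] M →ₗ[𝕜] FormTensor C k M :=
  LinearMap.mk₂ 𝕜 (ft C) (fun _ _ _ => add_ft C _ _ _) (fun _ _ _ => smul_ft C _ _ _)
    (fun _ _ _ => ft_add C _ _ _) (fun _ _ _ => ft_smul C _ _ _)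

@[simp] theorem ftHom_apply (ω : Forms C k) (m : M) : ftHom C ω m = ft C ω m := rfl

theorem ft_induction {p : FormTensor C k M → Prop} (x : FormTensor C k M)
    (h : ∀ ω m, p (ft C ω m)) (h0 : p 0) (hadd : ∀ x y, p x → p y → p (x + y)) : p x := by
  obtain ⟨t, rfl⟩ := (balanced C k M).mkQ_surjective x
  induction t using TensorProduct.induction_on with
  | zero => rw [map_zero]; exact h0
  | tmul ω m => exact h ω m
  | add s t hs ht => rw [map_add]; exact hadd _ _ hs ht

/-- A balanced `𝕜`-bilinear map descends to `Ωᵏ ⊗_A M`. -/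
def ftLift (f : Forms C k →ₗ[𝕜] M →ₗ[𝕜] P)
    (hf : ∀ ω a m, f (rmul C k a ω) m = f ω (a • m)) : FormTensor C k M →ₗ[𝕜] P :=
  Submodule.liftQ ((balanced C k M).restrictScalars 𝕜) (TensorProduct.lift f) (by
    intro x hx
    suffices h : ∀ a : A, TensorProduct.lift f (a • x) = 0 by simpa using h 1
    have hx' : x ∈ balanced C k M := hx
    clear hx
    unfold balanced at hx'
    induction hx' using Submodule.span_induction with
    | mem x h =>
      obtain ⟨ω, b, m, rfl⟩ := h
      intro a
      rw [smul_sub, TensorProduct.smul_tmul', TensorProduct.smul_tmul', ← map_smul (rmul C k b),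
        map_sub, TensorProduct.lift.tmul, TensorProduct.lift.tmul, hf, sub_self]
    | zero => intro a; simp
    | add x y _ _ h1 h2 => intro a; rw [smul_add, map_add, h1, h2, add_zero]
    | smul b x _ h1 => intro a; rw [smul_smul, h1])

@[simp] theorem ftLift_ft (f : Forms C k →ₗ[𝕜] M →ₗ[𝕜] P)
    (hf : ∀ ω a m, f (rmul C k a ω) m = f ω (a • m)) (ω : Forms C k) (m : M) :
    ftLift C f hf (ft C ω m) = f ω m := rfl

/-- A balanced `𝕜`-bilinear map that is `A`-linear on the left descends to an `A`-linear map. -/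
def ftLiftA (f : Forms C k →ₗ[𝕜] M →ₗ[𝕜] P)
    (hf : ∀ ω a m, f (rmul C k a ω) m = f ω (a • m))
    (hl : ∀ (a : A) ω m, f (a • ω) m = a • f ω m) : FormTensor C k M →ₗ[A] P where
  toFun := ftLift C f hf
  map_add' := map_add _
  map_smul' a x := by
    induction x using ft_induction with
    | h ω m => rw [← left_smul_ft]; exact hl a ω m
    | h0 => simp
    | hadd x y hx hy =>
      simp only [RingHom.id_apply] at hx hy ⊢
      rw [smul_add, map_add, hx, hy, map_add, smul_add]

@[simp] theorem ftLiftA_ft (f : Forms C k →ₗ[𝕜] M →ₗ[𝕜] P)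
    (hf : ∀ ω a m, f (rmul C k a ω) m = f ω (a • m))
    (hl : ∀ (a : A) ω m, f (a • ω) m = a • f ω m) (ω : Forms C k) (m : M) :
    ftLiftA C f hf hl (ft C ω m) = f ω m := rfl

variable (k) in
/-- The functor `Ωᵏ ⊗_A -` on morphisms. -/
def ftMap (f : M →ₗ[A] M') : FormTensor C k M →ₗ[A] FormTensor C k M' :=
  ftLiftA C ((ftHom C).compl₂ (f.restrictScalars 𝕜))
    (fun ω a m => by simp [rmul_ft]) (fun a ω m => by simp [left_smul_ft])

@[simp] theorem ftMap_ft (f : M →ₗ[A] M') (ω : Forms C k) (m : M) :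
    ftMap C k f (ft C ω m) = ft C ω (f m) := rfl

/-- The wedge product with a fixed one-form, `η ⊗ m ↦ ω ∧ η ⊗ m`. -/
def wedgeFix (ω : Forms C 1) : FormTensor C 1 M →ₗ[𝕜] FormTensor C 2 M :=
  ftLift C ((ftHom C).comp (wedge C ω)) (fun η a m => by
    simp only [LinearMap.comp_apply, ftHom_apply]
    rw [← rmul_ft]; congr 1; ext; simp [mul_assoc])

theorem wedgeFix_ft (ω η : Forms C 1) (m : M) :
    wedgeFix C ω (ft C η m) = ft C (wedge C ω η) m := rfl

/-- The wedge product with a one-form, `η ⊗ m ↦ ω ∧ η ⊗ m`, as a bilinear map. -/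
def wedgeLeft : Forms C 1 →ₗ[𝕜] FormTensor C 1 M →ₗ[𝕜] FormTensor C 2 M :=
  LinearMap.mk₂ 𝕜 (fun ω x => wedgeFix C ω x)
    (fun ω η x => by
      induction x using ft_induction with
      | h θ m =>
        rw [wedgeFix_ft, wedgeFix_ft, wedgeFix_ft, map_add, LinearMap.add_apply, add_ft]
      | h0 => simp
      | hadd x y hx hy => simp only [map_add, hx, hy]; abel)
    (fun c ω x => by
      induction x using ft_induction with
      | h θ m => rw [wedgeFix_ft, wedgeFix_ft, map_smul, LinearMap.smul_apply, smul_ft]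
      | h0 => simp
      | hadd x y hx hy => simp only [map_add, hx, hy, smul_add])
    (fun ω x y => map_add _ _ _) (fun c ω x => map_smul _ _ _)

@[simp] theorem wedgeLeft_ft (ω η : Forms C 1) (m : M) :
    wedgeLeft C ω (ft C η m) = ft C (wedge C ω η) m := rfl

theorem wedgeLeft_rmul (a : A) (ω : Forms C 1) (x : FormTensor C 1 M) :
    wedgeLeft C (rmul C 1 a ω) x = wedgeLeft C ω (a • x) := by
  induction x using ft_induction with
  | h θ m =>
    rw [← left_smul_ft, wedgeLeft_ft, wedgeLeft_ft]; congr 1; ext; simp [mul_assoc]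
  | h0 => simp
  | hadd x y hx hy => rw [smul_add, map_add, map_add, hx, hy]

theorem wedgeLeft_smul (a : A) (ω : Forms C 1) (x : FormTensor C 1 M) :
    wedgeLeft C (a • ω) x = a • wedgeLeft C ω x := by
  induction x using ft_induction with
  | h θ m =>
    rw [wedgeLeft_ft, wedgeLeft_ft, ← left_smul_ft]; congr 1; ext; simp [mul_assoc]
  | h0 => simp
  | hadd x y hx hy => rw [map_add, map_add, smul_add, hx, hy]

variable (M) in
/-- The wedge product `Ω¹ ⊗_A Ω¹ ⊗_A M → Ω² ⊗_A M`. -/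
def wedge11 : FormTensor C 1 (FormTensor C 1 M) →ₗ[A] FormTensor C 2 M :=
  ftLiftA C (wedgeLeft C) (fun ω a m => wedgeLeft_rmul C a ω m)
    (fun a ω m => wedgeLeft_smul C a ω m)

@[simp] theorem wedge11_ft (ω : Forms C 1) (x : FormTensor C 1 M) :
    wedge11 C M (ft C ω x) = wedgeLeft C ω x := rfl

end TensorMaps

/-! ### The 1-jet functor -/

/-- `N`, the elements `∑ aᵢ ⊗ bᵢ` of `A ⊗ A` with `∑ aᵢ bᵢ = 0` and `∑ aᵢ dbᵢ = 0`. -/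
def jetRel : Submodule 𝕜 (A ⊗[𝕜] A) :=
  LinearMap.ker (LinearMap.mul' 𝕜 A) ⊓ LinearMap.ker (adb C)

section OneJet

variable (M : Type u) [AddCommGroup M] [Module 𝕜 M] [Module A M] [IsScalarTower 𝕜 A M]

variable (𝕜 A) in
variable {M} in
/-- The map `∑ aᵢ ⊗ bᵢ ↦ ∑ aᵢ ⊗ bᵢ m`. -/
def actOn (m : M) : A ⊗[𝕜] A →ₗ[𝕜] A ⊗[𝕜] M :=
  LinearMap.lTensor A ((LinearMap.toSpanSingleton A M m).restrictScalars 𝕜)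

variable (𝕜 A) in
variable {M} in
@[simp] theorem actOn_tmul (m : M) (a b : A) : actOn 𝕜 A m (a ⊗ₜ b) = a ⊗ₜ (b • m) := rfl

variable (𝕜 A) in
variable {M} in
theorem actOn_smul (m : M) (a : A) (t : A ⊗[𝕜] A) :
    actOn 𝕜 A m (a • t) = a • actOn 𝕜 A m t := by
  induction t using TensorProduct.induction_on with
  | zero => simp
  | tmul x y => simp [TensorProduct.smul_tmul']
  | add s t hs ht => simp only [smul_add, map_add, hs, ht]

/-- The submodule of `A ⊗ M` generated by the `∑ aᵢ ⊗ bᵢ m` with `∑ aᵢ ⊗ bᵢ` in `N`. -/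
def jetRelOn : Submodule A (A ⊗[𝕜] M) :=
  Submodule.span A {x | ∃ t ∈ jetRel C, ∃ m : M, x = actOn 𝕜 A m t}

/-- The 1-jet module `J¹M = (A ⊗ A)/N ⊗_A M`, presented as the quotient of `A ⊗ M` by the image
of `N ⊗ M`. -/
def OneJet : Type u := (A ⊗[𝕜] M) ⧸ jetRelOn C M

instance : AddCommGroup (OneJet C M) :=
  inferInstanceAs (AddCommGroup ((A ⊗[𝕜] M) ⧸ jetRelOn C M))

instance : Module A (OneJet C M) :=
  inferInstanceAs (Module A ((A ⊗[𝕜] M) ⧸ jetRelOn C M))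

instance : Module 𝕜 (OneJet C M) :=
  inferInstanceAs (Module 𝕜 ((A ⊗[𝕜] M) ⧸ jetRelOn C M))

instance : IsScalarTower 𝕜 A (OneJet C M) :=
  inferInstanceAs (IsScalarTower 𝕜 A ((A ⊗[𝕜] M) ⧸ jetRelOn C M))

end OneJet

section OneJetMaps

variable {M : Type u} [AddCommGroup M] [Module 𝕜 M] [Module A M] [IsScalarTower 𝕜 A M]
variable {M' : Type u} [AddCommGroup M'] [Module 𝕜 M'] [Module A M'] [IsScalarTower 𝕜 A M']
variable {P : Type*} [AddCommGroup P] [Module 𝕜 P] [Module A P] [IsScalarTower 𝕜 A P]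

/-- The quotient map `A ⊗ M → J¹M`. -/
def jetMk : A ⊗[𝕜] M →ₗ[A] OneJet C M := (jetRelOn C M).mkQ

/-- The 1-jet prolongation `j¹(m) = [1 ⊗ m]`. -/
def prol : M →ₗ[𝕜] OneJet C M :=
  ((jetMk C).restrictScalars 𝕜).comp (TensorProduct.mk 𝕜 A M 1)

theorem jetMk_tmul (a : A) (m : M) : jetMk C (a ⊗ₜ[𝕜] m) = a • prol C m := by
  unfold prol
  simp only [LinearMap.comp_apply, LinearMap.restrictScalars_apply, TensorProduct.mk_apply]
  rw [← map_smul, TensorProduct.smul_tmul', smul_eq_mul, mul_one]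

theorem jetMk_actOn (m : M) {t : A ⊗[𝕜] A} (ht : t ∈ jetRel C) :
    jetMk C (actOn 𝕜 A m t) = 0 := by
  exact (Submodule.Quotient.mk_eq_zero (jetRelOn C M)).mpr (Submodule.subset_span ⟨t, ht, m, rfl⟩)

theorem oneJet_induction {p : OneJet C M → Prop} (x : OneJet C M)
    (h : ∀ (a : A) m, p (a • prol C m)) (h0 : p 0) (hadd : ∀ x y, p x → p y → p (x + y)) :
    p x := by
  obtain ⟨t, rfl⟩ := (jetRelOn C M).mkQ_surjective x
  induction t using TensorProduct.induction_on with
  | zero => rw [map_zero]; exact h0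
  | tmul a m => have := h a m; rw [← jetMk_tmul] at this; exact this
  | add s t hs ht => rw [map_add]; exact hadd _ _ hs ht

/-- A `𝕜`-bilinear map on `A × M` that respects `N` descends to `J¹M`. -/
def jetLift (f : A →ₗ[𝕜] M →ₗ[𝕜] P)
    (hf : ∀ t ∈ jetRel C, ∀ m, TensorProduct.lift f (actOn 𝕜 A m t) = 0) :
    OneJet C M →ₗ[𝕜] P :=
  Submodule.liftQ ((jetRelOn C M).restrictScalars 𝕜) (TensorProduct.lift f) (by
    intro x hx
    suffices h : ∀ a : A, TensorProduct.lift f (a • x) = 0 by simpa using h 1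
    have hx' : x ∈ jetRelOn C M := hx
    clear hx
    unfold jetRelOn at hx'
    induction hx' using Submodule.span_induction with
    | mem x h =>
      obtain ⟨t, ht, m, rfl⟩ := h
      intro a
      rw [← actOn_smul]
      refine hf _ ?_ m
      have h1 : ∀ s : A ⊗[𝕜] A, LinearMap.mul' 𝕜 A (a • s) = a * LinearMap.mul' 𝕜 A s := by
        intro s
        induction s using TensorProduct.induction_on with
        | zero => simp
        | tmul x y => simp [TensorProduct.smul_tmul', mul_assoc]
        | add s t hs ht => simp only [smul_add, map_add, hs, ht, mul_add]
      have h2 : ∀ s : A ⊗[𝕜] A, adb C (a • s) = a • adb C s := by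
        intro s
        induction s using TensorProduct.induction_on with
        | zero => simp
        | tmul x y => simp [TensorProduct.smul_tmul', mul_smul]
        | add s t hs ht => simp only [smul_add, map_add, hs, ht]
      obtain ⟨h3, h4⟩ := ht
      refine ⟨?_, ?_⟩
      · change LinearMap.mul' 𝕜 A (a • t) = 0
        have h3' : LinearMap.mul' 𝕜 A t = 0 := h3
        rw [h1, h3', mul_zero]
      · change adb C (a • t) = 0
        have h4' : adb C t = 0 := h4
        rw [h2, h4', smul_zero]
    | zero => intro a; simp
    | add x y _ _ h1 h2 => intro a; rw [smul_add, map_add, h1, h2, add_zero]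
    | smul b x _ h1 => intro a; rw [smul_smul, h1])

@[simp] theorem jetLift_smul_prol (f : A →ₗ[𝕜] M →ₗ[𝕜] P)
    (hf : ∀ t ∈ jetRel C, ∀ m, TensorProduct.lift f (actOn 𝕜 A m t) = 0) (a : A) (m : M) :
    jetLift C f hf (a • prol C m) = f a m := by
  rw [← jetMk_tmul]; rfl

variable (A) in
/-- The bilinear map `(a, m) ↦ a f(m)`. -/
def extendMap (f : M →ₗ[𝕜] P) : A →ₗ[𝕜] M →ₗ[𝕜] P :=
  LinearMap.mk₂ 𝕜 (fun a m => a • f m) (fun _ _ _ => add_smul _ _ _)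
    (fun c a m => smul_assoc c a _) (fun _ _ _ => by simp)
    (fun c a m => by rw [map_smul, smul_comm])

@[simp] theorem extendMap_apply (f : M →ₗ[𝕜] P) (a : A) (m : M) :
    extendMap A f a m = a • f m := rfl

/-- The `A`-linear map `[a ⊗ m] ↦ a f(m)` on `J¹M` induced by a `𝕜`-linear `f` such that
`∑ aᵢ f(bᵢ m) = 0` whenever `∑ aᵢ ⊗ bᵢ` is in `N`. -/
def jetLiftA (f : M →ₗ[𝕜] P)
    (hf : ∀ t ∈ jetRel C, ∀ m, TensorProduct.lift (extendMap A f) (actOn 𝕜 A m t) = 0) :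
    OneJet C M →ₗ[A] P where
  toFun := jetLift C (extendMap A f) hf
  map_add' := map_add _
  map_smul' a x := by
    induction x using oneJet_induction with
    | h b m =>
      change jetLift C _ hf (a • b • prol C m) = a • jetLift C _ hf (b • prol C m)
      rw [smul_smul, jetLift_smul_prol, jetLift_smul_prol, extendMap_apply, extendMap_apply,
        mul_smul]
    | h0 => simp
    | hadd x y hx hy =>
      simp only [RingHom.id_apply] at hx hy ⊢
      rw [smul_add, map_add, hx, hy, map_add, smul_add]

@[simp] theorem jetLiftA_prol (f : M →ₗ[𝕜] P)
    (hf : ∀ t ∈ jetRel C, ∀ m, TensorProduct.lift (extendMap A f) (actOn 𝕜 A m t) = 0) (m : M) :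
    jetLiftA C f hf (prol C m) = f m := by
  have h := jetLift_smul_prol C (extendMap A f) hf 1 m
  rw [one_smul, extendMap_apply, one_smul] at h
  exact h

/-- A bilinear expression that is a combination of `∑ aᵢ bᵢ` and `∑ aᵢ dbᵢ` vanishes on `N`. -/
theorem vanish_on_jetRel (f : A →ₗ[𝕜] M →ₗ[𝕜] P) (m : M) (g : A →ₗ[𝕜] P)
    (h : Forms C 1 →ₗ[𝕜] P) (hfgh : ∀ a b : A, f a (b • m) = g (a * b) + h (a • dA C b)) :
    ∀ t ∈ jetRel C, TensorProduct.lift f (actOn 𝕜 A m t) = 0 := by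
  have key : (TensorProduct.lift f).comp (actOn 𝕜 A m) =
      g.comp (LinearMap.mul' 𝕜 A) + h.comp (adb C) := by
    apply TensorProduct.ext'
    intro a b
    simp [hfgh]
  intro t ht
  have h3 : LinearMap.mul' 𝕜 A t = 0 := ht.1
  have h4 : adb C t = 0 := ht.2
  have := LinearMap.congr_fun key t
  simpa [h3, h4] using this

/-- The functor `J¹` on morphisms, `[a ⊗ m] ↦ [a ⊗ f(m)]`. -/
def jetMap (f : M →ₗ[A] M') : OneJet C M →ₗ[A] OneJet C M' :=
  jetLiftA C ((prol C).comp (f.restrictScalars 𝕜)) (by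
    intro t ht m
    have key : (TensorProduct.lift (extendMap A ((prol C).comp (f.restrictScalars 𝕜)))).comp
        (actOn 𝕜 A m) = ((jetMk C).restrictScalars 𝕜).comp (actOn 𝕜 A (f m)) := by
      apply TensorProduct.ext'
      intro a b
      simp [jetMk_tmul]
    have h := LinearMap.congr_fun key t
    simp only [LinearMap.comp_apply, LinearMap.restrictScalars_apply] at h
    rw [h, jetMk_actOn C _ ht])

@[simp] theorem jetMap_prol (f : M →ₗ[A] M') (m : M) :
    jetMap C f (prol C m) = prol C (f m) := by
  simp [jetMap]

variable (M) in
/-- The projection `π : J¹M → M`, `[a ⊗ m] ↦ a m`. -/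
def proj : OneJet C M →ₗ[A] M :=
  jetLiftA C LinearMap.id (fun t ht m =>
    vanish_on_jetRel C _ m ((LinearMap.toSpanSingleton A M m).restrictScalars 𝕜) 0
      (fun a b => by simp [mul_smul]) t ht)

@[simp] theorem proj_prol (m : M) : proj C M (prol C m) = m := by
  simp [proj]

variable (M) in
/-- The `𝕜`-linear map `ρ : J¹M → Ω¹ ⊗_A M`, `[a ⊗ m] ↦ -da ⊗ m`. -/
def rho : OneJet C M →ₗ[𝕜] FormTensor C 1 M :=
  jetLift C (-((ftHom C).comp (dA C))) (fun t ht m =>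
    vanish_on_jetRel C _ m (-(((ftHom C).flip m).comp (dA C))) ((ftHom C).flip m)
      (fun a b => by simp [← rmul_ft, dA_mul]) t ht)

@[simp] theorem rho_smul_prol (a : A) (m : M) :
    rho C M (a • prol C m) = -ft C (dA C a) m := by
  simp [rho]

@[simp] theorem rho_prol (m : M) : rho C M (prol C m) = 0 := by
  have h := rho_smul_prol C 1 m
  rw [one_smul, dA_one, ← ftHom_apply] at h
  simpa using h

theorem rho_smul (a : A) (x : OneJet C M) :
    rho C M (a • x) = a • rho C M x - ft C (dA C a) (proj C M x) := by
  induction x using oneJet_induction with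
  | h b m =>
    rw [smul_smul, rho_smul_prol, rho_smul_prol, map_smul, proj_prol, dA_mul, add_ft, rmul_ft,
      left_smul_ft, smul_neg]
    abel
  | h0 => simp [ft_zero]
  | hadd x y hx hy =>
    rw [smul_add, map_add, hx, hy, map_add, map_add, ft_add, smul_add]; abel

/-- The expression `a ⊗ b ↦ [a ⊗ b m] - [a b ⊗ m]`. -/
def iotaAux (m : M) : A ⊗[𝕜] A →ₗ[𝕜] OneJet C M :=
  ((jetMk C).restrictScalars 𝕜).comp (actOn 𝕜 A m) -
    ((LinearMap.toSpanSingleton A (OneJet C M) (prol C m)).restrictScalars 𝕜).comp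
      (LinearMap.mul' 𝕜 A)

@[simp] theorem iotaAux_tmul (m : M) (a b : A) :
    iotaAux C m (a ⊗ₜ b) = a • prol C (b • m) - (a * b) • prol C m := by
  simp [iotaAux, jetMk_tmul]

theorem iotaAux_eq_zero (m : M) {t : A ⊗[𝕜] A} (ht : adb C t = 0) : iotaAux C m t = 0 := by
  have hmem : t - (LinearMap.mul' 𝕜 A t) ⊗ₜ[𝕜] (1 : A) ∈ jetRel C := by
    refine ⟨?_, ?_⟩
    · change LinearMap.mul' 𝕜 A _ = 0
      simp
    · change adb C _ = 0
      simp [ht, dA_one]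
  have h := jetMk_actOn C m hmem
  rw [map_sub, map_sub, actOn_tmul, jetMk_tmul, one_smul] at h
  exact h

theorem iotaAux_eq (m : M) {s t : A ⊗[𝕜] A} (h : adb C s = adb C t) :
    iotaAux C m s = iotaAux C m t := by
  rw [← sub_eq_zero, ← map_sub]
  exact iotaAux_eq_zero C m (by rw [map_sub, h, sub_self])

/-- The value of `ι` on `ω ⊗ m`, computed from any representation `ω = ∑ aᵢ dbᵢ`. -/
noncomputable def iotaFun (ω : Forms C 1) (m : M) : OneJet C M :=
  iotaAux C m (Function.surjInv (adb_surjective C) ω)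

theorem iotaFun_adb (t : A ⊗[𝕜] A) (m : M) : iotaFun C (adb C t) m = iotaAux C m t :=
  iotaAux_eq C m (Function.surjInv_eq (adb_surjective C) _)

theorem iotaAux_add (m n : M) (t : A ⊗[𝕜] A) :
    iotaAux C (m + n) t = iotaAux C m t + iotaAux C n t := by
  induction t using TensorProduct.induction_on with
  | zero => simp
  | tmul a b => simp; abel
  | add s t hs ht => simp only [map_add, hs, ht]; abel

theorem iotaAux_ksmul (c : 𝕜) (m : M) (t : A ⊗[𝕜] A) :
    iotaAux C (c • m) t = c • iotaAux C m t := by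
  induction t using TensorProduct.induction_on with
  | zero => simp
  | tmul a b =>
    simp only [iotaAux_tmul, map_smul, smul_sub]
    rw [smul_comm b c m, map_smul, smul_comm a c, smul_comm (a * b) c]
  | add s t hs ht => simp only [map_add, hs, ht, smul_add]

variable (M) in
/-- The inclusion `ι : Ω¹ ⊗_A M → J¹M`, `a db ⊗ m ↦ [a ⊗ b m] - [a b ⊗ m]`. -/
noncomputable def iota : FormTensor C 1 M →ₗ[A] OneJet C M :=
  ftLiftA C
    (LinearMap.mk₂ 𝕜 (iotaFun C)
      (fun ω η m => by
        obtain ⟨s, rfl⟩ := adb_surjective C ω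
        obtain ⟨t, rfl⟩ := adb_surjective C η
        rw [← map_add, iotaFun_adb, iotaFun_adb, iotaFun_adb, map_add])
      (fun c ω m => by
        obtain ⟨s, rfl⟩ := adb_surjective C ω
        rw [← map_smul, iotaFun_adb, iotaFun_adb, map_smul])
      (fun ω m n => iotaAux_add C m n _)
      (fun c ω m => iotaAux_ksmul C c m _))
    (fun ω a m => by
      obtain ⟨s, rfl⟩ := adb_surjective C ω
      change iotaFun C (rmul C 1 a (adb C s)) m = iotaFun C (adb C s) (a • m)
      induction s using TensorProduct.induction_on with
      | zero =>
        simp only [map_zero]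
        rw [← map_zero (adb C), iotaFun_adb, iotaFun_adb]; simp
      | tmul x y =>
        have h : rmul C 1 a (adb C (x ⊗ₜ y)) = adb C (x ⊗ₜ (y * a) - (x * y) ⊗ₜ a) := by
          simp [dA_mul, mul_smul]
        rw [h, iotaFun_adb, iotaFun_adb]
        simp [mul_smul, mul_assoc]
      | add s t hs ht =>
        obtain ⟨s', hs'⟩ := adb_surjective C (rmul C 1 a (adb C s))
        obtain ⟨t', ht'⟩ := adb_surjective C (rmul C 1 a (adb C t))
        rw [← hs', iotaFun_adb, iotaFun_adb] at hs
        rw [← ht', iotaFun_adb, iotaFun_adb] at ht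
        rw [map_add, map_add, ← hs', ← ht', ← map_add, ← map_add, iotaFun_adb, iotaFun_adb,
          map_add, map_add, hs, ht])
    (fun a ω m => by
      obtain ⟨s, rfl⟩ := adb_surjective C ω
      change iotaFun C (a • adb C s) m = a • iotaFun C (adb C s) m
      have h : a • adb C s = adb C (a • s) := by
        induction s using TensorProduct.induction_on with
        | zero => simp
        | tmul x y => simp [TensorProduct.smul_tmul', mul_smul]
        | add s t hs ht => simp only [smul_add, map_add, hs, ht]
      rw [h, iotaFun_adb, iotaFun_adb]
      clear h
      induction s using TensorProduct.induction_on with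
      | zero => simp
      | tmul x y => simp [TensorProduct.smul_tmul', mul_smul, smul_sub]
      | add s t hs ht => simp only [smul_add, map_add, hs, ht])

theorem iota_adb (a b : A) (m : M) :
    iota C M (ft C (a • dA C b) m) = a • prol C (b • m) - (a * b) • prol C m := by
  rw [← iotaAux_tmul, ← iotaFun_adb]; rfl

/-- `Ω¹ ⊗_A M` is spanned by the elements `a db ⊗ m`. -/
theorem ft_one_induction {p : FormTensor C 1 M → Prop} (x : FormTensor C 1 M)
    (h : ∀ (a b : A) m, p (ft C (a • dA C b) m)) (h0 : p 0)
    (hadd : ∀ x y, p x → p y → p (x + y)) : p x := by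
  induction x using ft_induction with
  | h ω m =>
    obtain ⟨t, rfl⟩ := adb_surjective C ω
    induction t using TensorProduct.induction_on with
    | zero => rw [map_zero, ← ftHom_apply, map_zero]; exact h0
    | tmul a b => exact h a b m
    | add s t hs ht => rw [map_add, add_ft]; exact hadd _ _ hs ht
  | h0 => exact h0
  | hadd x y hx hy => exact hadd x y hx hy

theorem iota_natural (f : M →ₗ[A] M') (x : FormTensor C 1 M) :
    jetMap C f (iota C M x) = iota C M' (ftMap C 1 f x) := by
  induction x using ft_one_induction with
  | h a b m => simp [iota_adb]
  | h0 => simp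
  | hadd x y hx hy => simp only [map_add, hx, hy]

@[simp] theorem proj_iota (x : FormTensor C 1 M) : proj C M (iota C M x) = 0 := by
  induction x using ft_one_induction with
  | h a b m => simp [iota_adb, mul_smul]
  | h0 => simp
  | hadd x y hx hy => simp only [map_add, hx, hy, add_zero]

@[simp] theorem rho_iota (x : FormTensor C 1 M) : rho C M (iota C M x) = x := by
  induction x using ft_one_induction with
  | h a b m =>
    rw [iota_adb, map_sub, rho_smul_prol, rho_smul_prol, dA_mul, add_ft, rmul_ft]; abel
  | h0 => simp
  | hadd x y hx hy => simp only [map_add, hx, hy]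

/-! ### The operator whose kernel cuts out holonomic jets -/

variable (M) in
/-- `[a ⊗ b] ⊗ [c ⊗ m] ↦ a d(b c) ⊗ m`, from `J¹J¹M` to `Ω¹ ⊗_A M`. -/
def DI : OneJet C (OneJet C M) →ₗ[A] FormTensor C 1 M :=
  jetLiftA C (-rho C M) (fun t ht x =>
    vanish_on_jetRel C _ x
      (-((LinearMap.toSpanSingleton A (FormTensor C 1 M) (rho C M x)).restrictScalars 𝕜))
      ((ftHom C).flip (proj C M x))
      (fun a b => by
        simp only [extendMap_apply, LinearMap.neg_apply, rho_smul, LinearMap.flip_apply,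
          ftHom_apply, left_smul_ft, LinearMap.restrictScalars_apply,
          LinearMap.toSpanSingleton_apply, mul_smul, smul_neg, smul_sub]
        abel) t ht)

@[simp] theorem DI_prol (x : OneJet C M) : DI C M (prol C x) = -rho C M x := by
  simp [DI]

theorem wedge_dA_dA (a b : A) :
    (wedge C (dA C a) (dA C b)).val = C.d (C.incl a * C.d (C.incl b)) := by
  rw [C.leibniz (C.incl_mem a), C.d_d]; simp

/-- The restriction of the differential to a map `Ω¹ → Ω²`. -/
def d1 : Forms C 1 →ₗ[𝕜] Forms C 2 where
  toFun ω := Forms.mk (C.d ω.val) (C.d_mem ω.val_mem)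
  map_add' ω η := by ext; simp
  map_smul' c ω := by ext; simp

theorem d1_smul_dA (a b : A) : d1 C (a • dA C b) = wedge C (dA C a) (dA C b) := by
  ext; rw [wedge_dA_dA]; rfl

variable (M) in
/-- `[a ⊗ b] ⊗ [c ⊗ m] ↦ da ∧ d(b c) ⊗ m`, from `J¹J¹M` to `Ω² ⊗_A M`. -/
def DII : OneJet C (OneJet C M) →ₗ[𝕜] FormTensor C 2 M :=
  jetLift C (((wedgeLeft C).comp (dA C)).compl₂ (-rho C M)) (fun t ht x =>
    vanish_on_jetRel C _ x
      (-(((wedgeLeft C).flip (rho C M x)).comp (dA C)))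
      (((ftHom C).flip (proj C M x)).comp (d1 C) + (wedgeLeft C).flip (rho C M x))
      (fun a b => by
        simp only [LinearMap.compl₂_apply, LinearMap.comp_apply, LinearMap.neg_apply, rho_smul,
          LinearMap.add_apply, LinearMap.flip_apply, ftHom_apply, d1_smul_dA, dA_mul, map_neg,
          map_sub, map_add, wedgeLeft_ft, wedgeLeft_rmul]
        abel) t ht)

@[simp] theorem DII_smul_prol (a : A) (x : OneJet C M) :
    DII C M (a • prol C x) = -wedgeLeft C (dA C a) (rho C M x) := by
  simp [DII]

theorem DI_formula (a b c : A) (m : M) :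
    DI C M (a • prol C (b • c • prol C m)) = ft C (a • dA C (b * c)) m := by
  rw [map_smul, DI_prol, smul_smul, rho_smul_prol, neg_neg, left_smul_ft]

theorem DII_formula (a b c : A) (m : M) :
    DII C M (a • prol C (b • c • prol C m)) = ft C (wedge C (dA C a) (dA C (b * c))) m := by
  rw [DII_smul_prol, smul_smul, rho_smul_prol, map_neg, neg_neg, wedgeLeft_ft]

theorem DII_smul (a : A) (x : OneJet C (OneJet C M)) :
    DII C M (a • x) = a • DII C M x + wedgeLeft C (dA C a) (DI C M x) := by
  induction x using oneJet_induction with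
  | h b y =>
    rw [smul_smul, DII_smul_prol, DII_smul_prol, map_smul, DI_prol, dA_mul, map_add,
      LinearMap.add_apply, wedgeLeft_rmul, wedgeLeft_smul, smul_neg, smul_neg, map_neg]
    abel
  | h0 => simp
  | hadd x y hx hy => rw [smul_add, map_add, hx, hy, map_add, map_add, map_add, smul_add]; abel

theorem DI_iota_iota (x : FormTensor C 1 (FormTensor C 1 M)) :
    DI C M (jetMap C (iota C M) (iota C _ x)) = 0 := by
  induction x using ft_one_induction with
  | h a b y =>
    rw [iota_adb, map_sub, LinearMap.map_smul (jetMap C _), LinearMap.map_smul (jetMap C _),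
      jetMap_prol, jetMap_prol, map_sub, LinearMap.map_smul (DI C M), LinearMap.map_smul (DI C M),
      DI_prol, DI_prol, rho_iota, rho_iota, smul_neg, smul_neg, mul_smul, sub_self]
  | h0 => simp
  | hadd x y hx hy => simp only [map_add, hx, hy, add_zero]

theorem DII_iota_iota (x : FormTensor C 1 (FormTensor C 1 M)) :
    DII C M (jetMap C (iota C M) (iota C _ x)) = wedge11 C M x := by
  induction x using ft_one_induction with
  | h a b y =>
    rw [iota_adb, map_sub, LinearMap.map_smul (jetMap C _),
      LinearMap.map_smul (jetMap C _), jetMap_prol, jetMap_prol, map_sub, DII_smul_prol,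
      DII_smul_prol, rho_iota, rho_iota, wedge11_ft, dA_mul, map_add, LinearMap.add_apply,
      wedgeLeft_rmul]
    abel
  | h0 => simp
  | hadd x y hx hy => simp only [map_add, hx, hy]

theorem wedge11_natural (f : M →ₗ[A] M') (x : FormTensor C 1 (FormTensor C 1 M)) :
    wedge11 C M' (ftMap C 1 (ftMap C 1 f) x) = ftMap C 2 f (wedge11 C M x) := by
  induction x using ft_induction with
  | h ω y =>
    rw [ftMap_ft, wedge11_ft, wedge11_ft]
    induction y using ft_induction with
    | h η m => simp
    | h0 => simp
    | hadd x y hx hy => simp only [map_add, hx, hy]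
  | h0 => simp
  | hadd x y hx hy => simp only [map_add, hx, hy]

end OneJetMaps

section Higher

variable {M : Type u} [AddCommGroup M] [Module 𝕜 M] [Module A M] [IsScalarTower 𝕜 A M]
variable {M' : Type u} [AddCommGroup M'] [Module 𝕜 M'] [Module A M'] [IsScalarTower 𝕜 A M']

/-- For `l : Jⁿ⁺¹ → J¹Jⁿ`, the holonomic part of `J¹Jⁿ⁺¹`: the kernel of
`J¹Jⁿ⁺¹ → J¹J¹Jⁿ → (Ω¹ × Ω²)Jⁿ`. -/
def holonomic (l : M' →ₗ[A] OneJet C M) : Submodule A (OneJet C M') where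
  carrier := {x | DI C M (jetMap C l x) = 0 ∧ DII C M (jetMap C l x) = 0}
  add_mem' := by
    rintro x y ⟨h1, h2⟩ ⟨h3, h4⟩
    exact ⟨by rw [map_add, map_add, h1, h3, add_zero], by rw [map_add, map_add, h2, h4, add_zero]⟩
  zero_mem' := ⟨by simp, by simp⟩
  smul_mem' := by
    rintro a x ⟨h1, h2⟩
    exact ⟨by rw [map_smul, map_smul, h1, smul_zero],
      by rw [map_smul, DII_smul, h1, h2]; simp⟩

/-- For `l : Sⁿ⁺¹ → Ω¹Sⁿ`, the symmetric part of `Ω¹Sⁿ⁺¹`: the kernel of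
`Ω¹Sⁿ⁺¹ → Ω¹Ω¹Sⁿ → Ω²Sⁿ`. -/
def symmetric (l : M' →ₗ[A] FormTensor C 1 M) : Submodule A (FormTensor C 1 M') :=
  LinearMap.ker ((wedge11 C M).comp (ftMap C 1 l))

end Higher

/-! ### Holonomic jets and symmetric forms of all orders -/

variable (𝕜 A) in
/-- A bundled left `A`-module (with its induced `𝕜`-module structure). -/
structure LMod where
  carrier : Type u
  [grp : AddCommGroup carrier]
  [modk : Module 𝕜 carrier]
  [modA : Module A carrier]
  [tower : IsScalarTower 𝕜 A carrier]

attribute [instance] LMod.grp LMod.modk LMod.modA LMod.tower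

variable (E : Type u) [AddCommGroup E] [Module 𝕜 E] [Module A E] [IsScalarTower 𝕜 A E]

/-- Two consecutive jet modules `JⁿE`, `Jⁿ⁺¹E` with the map `l : Jⁿ⁺¹E → J¹JⁿE` and the
prolongations of elements of `E`. -/
structure JetStage where
  lo : LMod.{u} 𝕜 A
  hi : LMod.{u} 𝕜 A
  l : hi.carrier →ₗ[A] OneJet C lo.carrier
  jlo : E →ₗ[𝕜] lo.carrier
  jhi : E →ₗ[𝕜] hi.carrier
  l_jhi : ∀ e, l (jhi e) = prol C (jlo e)

/-- The jet modules of orders `0` and `1`. -/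
def JetStage.zero : JetStage C E where
  lo := ⟨E⟩
  hi := ⟨OneJet C E⟩
  l := LinearMap.id
  jlo := LinearMap.id
  jhi := prol C
  l_jhi _ := rfl

variable {C E} in
/-- From the jet modules of orders `n`, `n + 1` to those of orders `n + 1`, `n + 2`. -/
def JetStage.succ (s : JetStage C E) : JetStage C E where
  lo := s.hi
  hi := ⟨↥(holonomic C s.l)⟩
  l := (holonomic C s.l).subtype
  jlo := s.jhi
  jhi := LinearMap.codRestrict ((holonomic C s.l).restrictScalars 𝕜) ((prol C).comp s.jhi)
    (fun e => by
      have h : jetMap C s.l (prol C (s.jhi e)) = prol C (prol C (s.jlo e)) := by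
        rw [jetMap_prol, s.l_jhi]
      refine ⟨?_, ?_⟩
      · rw [LinearMap.comp_apply, h, DI_prol, rho_prol, neg_zero]
      · have h2 := DII_smul_prol C 1 (prol C (s.jlo e))
        rw [LinearMap.comp_apply, h]
        simpa using h2)
  l_jhi _ := rfl

/-- The tower of holonomic jet modules. -/
def jetStage : ℕ → JetStage C E
  | 0 => JetStage.zero C E
  | n + 1 => (jetStage n).succ

/-- The holonomic jet module `JⁿE`: `J⁰E = E`, `J¹E`, and for `n ≥ 2` the kernel of
`J¹Jⁿ⁻¹E → J¹J¹Jⁿ⁻²E → (Ω¹ × Ω²)Jⁿ⁻²E`. -/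
abbrev Jet (n : ℕ) : Type u := (jetStage C E n).lo.carrier

/-- The natural map `l : Jⁿ⁺¹E → J¹JⁿE`. -/
def jetIncl (n : ℕ) : Jet C E (n + 1) →ₗ[A] OneJet C (Jet C E n) := (jetStage C E n).l

/-- The jet prolongation `jⁿ : E → JⁿE`. -/
def jetProl (n : ℕ) : E →ₗ[𝕜] Jet C E n := (jetStage C E n).jlo

/-- The jet projection `π : Jⁿ⁺¹E → JⁿE`. -/
def jetProj (n : ℕ) : Jet C E (n + 1) →ₗ[A] Jet C E n :=
  (proj C (Jet C E n)).comp (jetIncl C E n)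

/-- Two consecutive modules `SⁿE`, `Sⁿ⁺¹E` of symmetric forms with the map `Sⁿ⁺¹E → Ω¹SⁿE`. -/
structure SymStage where
  lo : LMod.{u} 𝕜 A
  hi : LMod.{u} 𝕜 A
  l : hi.carrier →ₗ[A] FormTensor C 1 lo.carrier

/-- Symmetric forms of orders `0` and `1`. -/
def SymStage.zero : SymStage C where
  lo := ⟨E⟩
  hi := ⟨FormTensor C 1 E⟩
  l := LinearMap.id

variable {C} in
/-- From symmetric forms of orders `n`, `n + 1` to those of orders `n + 1`, `n + 2`. -/
def SymStage.succ (s : SymStage C) : SymStage C where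
  lo := s.hi
  hi := ⟨↥(symmetric C s.l)⟩
  l := (symmetric C s.l).subtype

/-- The tower of symmetric forms with values in `E`. -/
def symStage : ℕ → SymStage C
  | 0 => SymStage.zero C E
  | n + 1 => (symStage n).succ

/-- The module `SⁿE` of symmetric forms: `S⁰E = E`, `S¹E = Ω¹ ⊗_A E`, and for `n ≥ 2` the kernel
of `Ω¹Sⁿ⁻¹E → Ω¹Ω¹Sⁿ⁻²E → Ω²Sⁿ⁻²E`. -/
abbrev Sym (n : ℕ) : Type u := (symStage C E n).lo.carrier

/-- The inclusion `ι_∧ : Sⁿ⁺¹E → Ω¹ ⊗_A SⁿE`; it is the identity for `n = 0`. -/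
def symIncl (n : ℕ) : Sym C E (n + 1) →ₗ[A] FormTensor C 1 (Sym C E n) := (symStage C E n).l

variable {C E} in
/-- Compatible maps `SⁿE → JⁿE` and `Sⁿ⁺¹E → Jⁿ⁺¹E`. -/
structure IotaStage (s : SymStage C) (t : JetStage C E) where
  lo : s.lo.carrier →ₗ[A] t.lo.carrier
  hi : s.hi.carrier →ₗ[A] t.hi.carrier
  compat : ∀ x, t.l (hi x) = iota C t.lo.carrier (ftMap C 1 lo (s.l x))

/-- The maps in orders `0` and `1`. -/
noncomputable def IotaStage.zero : IotaStage (SymStage.zero C E) (JetStage.zero C E) where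
  lo := LinearMap.id
  hi := iota C E
  compat x := by
    have h : ∀ y : FormTensor C 1 E, ftMap C 1 LinearMap.id y = y := by
      intro y
      induction y using ft_induction with
      | h ω m => rfl
      | h0 => simp
      | hadd x y hx hy => rw [map_add, hx, hy]
    exact congrArg (iota C E) (h x).symm

variable {C E} in
/-- The map of order `n + 2` is obtained by restricting
`Sⁿ⁺²E → Ω¹Sⁿ⁺¹E → Ω¹Jⁿ⁺¹E → J¹Jⁿ⁺¹E`. -/
noncomputable def IotaStage.succ {s : SymStage C} {t : JetStage C E} (i : IotaStage s t) :
    IotaStage s.succ t.succ where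
  lo := i.hi
  hi := LinearMap.codRestrict (holonomic C t.l)
    ((iota C t.hi.carrier).comp ((ftMap C 1 i.hi).comp (symmetric C s.l).subtype))
    (fun x => by
      have h : jetMap C t.l (iota C t.hi.carrier (ftMap C 1 i.hi x.1)) =
          jetMap C (iota C t.lo.carrier) (iota C _ (ftMap C 1 (ftMap C 1 i.lo)
            (ftMap C 1 s.l x.1))) := by
        rw [iota_natural, iota_natural]
        congr 1
        induction x.1 using ft_induction with
        | h ω m => simp [i.compat]
        | h0 => simp
        | hadd x y hx hy => simp only [map_add, hx, hy]
      have hx : wedge11 C s.lo.carrier (ftMap C 1 s.l x.1) = 0 := x.2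
      refine ⟨?_, ?_⟩
      · change DI C _ (jetMap C t.l (iota C t.hi.carrier (ftMap C 1 i.hi x.1))) = 0
        rw [h, DI_iota_iota]
      · change DII C _ (jetMap C t.l (iota C t.hi.carrier (ftMap C 1 i.hi x.1))) = 0
        rw [h, DII_iota_iota, wedge11_natural, hx, map_zero])
  compat _ := rfl

/-- The tower of maps from symmetric forms to jets. -/
noncomputable def iotaStage : (n : ℕ) → IotaStage (symStage C E n) (jetStage C E n)
  | 0 => IotaStage.zero C E
  | n + 1 => (iotaStage n).succ

/-- The natural map `ιⁿ : SⁿE → JⁿE`. -/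
noncomputable def jetIota (n : ℕ) : Sym C E n →ₗ[A] Jet C E n := (iotaStage C E n).lo

theorem jetIncl_jetProl (n : ℕ) (e : E) :
    jetIncl C E n (jetProl C E (n + 1) e) = prol C (jetProl C E n e) :=
  (jetStage C E n).l_jhi e

theorem jetProj_jetProl (n : ℕ) (e : E) :
    jetProj C E n (jetProl C E (n + 1) e) = jetProl C E n e := by
  rw [jetProj, LinearMap.comp_apply, jetIncl_jetProl, proj_prol]

theorem jetIncl_jetIota (n : ℕ) (x : Sym C E (n + 1)) :
    jetIncl C E n (jetIota C E (n + 1) x) =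
      iota C (Jet C E n) (ftMap C 1 (jetIota C E n) (symIncl C E n x)) :=
  (iotaStage C E n).compat x

theorem jetProj_jetIota (n : ℕ) (x : Sym C E (n + 1)) :
    jetProj C E n (jetIota C E (n + 1) x) = 0 := by
  rw [jetProj, LinearMap.comp_apply, jetIncl_jetIota, proj_iota]

/-- Right exactness of the `n`-jet sequence `SⁿE → JⁿE → Jⁿ⁻¹E → 0` at `E`, where `J⁻¹E = 0`. -/
def JetRightExact : ℕ → Prop
  | 0 => Function.Surjective (jetIota C E 0)
  | n + 1 => Function.Exact (jetIota C E (n + 1)) (jetProj C E n) ∧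
      Function.Surjective (jetProj C E n)

/-- The module of elemental jets: the `A`-submodule of `JⁿE` generated by prolongations. -/
def elementalJets (n : ℕ) : Submodule A (Jet C E n) :=
  Submodule.span A (Set.range (jetProl C E n))

/-! ### Differential operators and symbols -/

section Operators

variable (n : ℕ)
variable (F : Type v) [AddCommGroup F] [Module 𝕜 F] [Module A F] [IsScalarTower 𝕜 A F]

/-- Linear differential operators `E → F` of order at most `n`: the `𝕜`-linear maps that factor as
an `A`-linear map `JⁿE → F` after the prolongation `jⁿ`. -/
def DiffOp : Submodule 𝕜 (E →ₗ[𝕜] F) where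
  carrier := {Δ | ∃ L : Jet C E n →ₗ[A] F, ∀ e, Δ e = L (jetProl C E n e)}
  add_mem' := by
    rintro Δ Δ' ⟨L, hL⟩ ⟨L', hL'⟩
    exact ⟨L + L', fun e => by simp [hL, hL']⟩
  zero_mem' := ⟨0, fun e => by simp⟩
  smul_mem' := by
    rintro c Δ ⟨L, hL⟩
    exact ⟨c • L, fun e => by simp [hL]⟩

/-- Differential operators of order at most `n - 1`, where only `0` has order at most `-1`. -/
def DiffOpLower : ℕ → Submodule 𝕜 (E →ₗ[𝕜] F)
  | 0 => ⊥
  | n + 1 => DiffOp C E n F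

theorem diffOp_le_succ : DiffOp C E n F ≤ DiffOp C E (n + 1) F := by
  rintro Δ ⟨L, hL⟩
  exact ⟨L.comp (jetProj C E n), fun e => by
    rw [LinearMap.comp_apply, jetProj_jetProl, hL]⟩

theorem diffOp_mono : Monotone (fun n => DiffOp C E n F) :=
  monotone_nat_of_le_succ fun n => diffOp_le_succ C E n F

/-- Differential operators of finite order. -/
def DiffOpFin : Submodule 𝕜 (E →ₗ[𝕜] F) where
  carrier := {Δ | ∃ n, Δ ∈ DiffOp C E n F}
  add_mem' := by
    rintro Δ Δ' ⟨n, hn⟩ ⟨m, hm⟩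
    exact ⟨max n m, add_mem (diffOp_mono C E F (le_max_left n m) hn)
      (diffOp_mono C E F (le_max_right n m) hm)⟩
  zero_mem' := ⟨0, zero_mem _⟩
  smul_mem' := by
    rintro c Δ ⟨n, hn⟩
    exact ⟨n, Submodule.smul_mem _ c hn⟩

/-- The inclusion of operators of order at most `n` into those of finite order. -/
def toFin : DiffOp C E n F →ₗ[𝕜] DiffOpFin C E F :=
  Submodule.inclusion (fun _ h => ⟨n, h⟩)

/-- The module of symbols of order `n`: operators of order at most `n` modulo operators of order
at most `n - 1`. -/
abbrev Symb : Type _ := DiffOp C E n F ⧸ (DiffOpLower C E F n).submoduleOf (DiffOp C E n F)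

/-- The symbol map `ςⁿ`. -/
def symbol : DiffOp C E n F →ₗ[𝕜] Symb C E n F :=
  ((DiffOpLower C E F n).submoduleOf (DiffOp C E n F)).mkQ

/-- The graded module of symbols `⨁ₙ Symbⁿ(E, F)`. -/
abbrev SymbAll : Type _ := ⨁ n : ℕ, Symb C E n F

variable {F}
variable {G : Type v} [AddCommGroup G] [Module 𝕜 G] [Module A G] [IsScalarTower 𝕜 A G]

theorem comp_mem_diffOp (φ : F →ₗ[A] G) {Δ : E →ₗ[𝕜] F} (h : Δ ∈ DiffOp C E n F) :
    (φ.restrictScalars 𝕜).comp Δ ∈ DiffOp C E n G := by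
  obtain ⟨L, hL⟩ := h
  exact ⟨φ.comp L, fun e => by simp [hL]⟩

theorem comp_mem_diffOpLower (φ : F →ₗ[A] G) {Δ : E →ₗ[𝕜] F} (h : Δ ∈ DiffOpLower C E F n) :
    (φ.restrictScalars 𝕜).comp Δ ∈ DiffOpLower C E G n := by
  cases n with
  | zero =>
    have h0 : Δ = 0 := h
    rw [h0, LinearMap.comp_zero]
    exact zero_mem _
  | succ n => exact comp_mem_diffOp C E n φ h

/-- The functor `Diffⁿ(E, -)` on morphisms: composition with `φ`. -/
def diffMap (φ : F →ₗ[A] G) : DiffOp C E n F →ₗ[𝕜] DiffOp C E n G :=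
  LinearMap.restrict (LinearMap.compRight 𝕜 (φ.restrictScalars 𝕜))
    (fun _ h => comp_mem_diffOp C E n φ h)

/-- The functor `Diff(E, -)` on morphisms: composition with `φ`. -/
def diffFinMap (φ : F →ₗ[A] G) : DiffOpFin C E F →ₗ[𝕜] DiffOpFin C E G :=
  LinearMap.restrict (LinearMap.compRight 𝕜 (φ.restrictScalars 𝕜))
    (fun _ ⟨n, h⟩ => ⟨n, comp_mem_diffOp C E n φ h⟩)

/-- The functor `Symbⁿ(E, -)` on morphisms, induced by composition with `φ`. -/
def symbMap (φ : F →ₗ[A] G) : Symb C E n F →ₗ[𝕜] Symb C E n G :=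
  Submodule.mapQ _ _ (diffMap C E n φ) (fun _ h => comp_mem_diffOpLower C E n φ h)

/-- The functor `⨁ₙ Symbⁿ(E, -)` on morphisms. -/
noncomputable def symbAllMap (φ : F →ₗ[A] G) : SymbAll C E F →ₗ[𝕜] SymbAll C E G :=
  DirectSum.lmap (fun n => symbMap C E n φ)

end Operators

/-! ### The restriction symbol -/

section Restriction

variable {n : ℕ}
variable {F : Type v} [AddCommGroup F] [Module 𝕜 F] [Module A F] [IsScalarTower 𝕜 A F]

variable {C E} in
/-- If symmetric forms are elemental jets, two lifts of the same operator agree on them. -/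
theorem lift_iota_unique (h : LinearMap.range (jetIota C E n) ≤ elementalJets C E n)
    (L L' : Jet C E n →ₗ[A] F) (hL : ∀ e, L (jetProl C E n e) = L' (jetProl C E n e)) :
    L.comp (jetIota C E n) = L'.comp (jetIota C E n) := by
  ext x
  have hx : jetIota C E n x ∈ LinearMap.eqLocus L L' := by
    have hle : elementalJets C E n ≤ LinearMap.eqLocus L L' := by
      refine Submodule.span_le.mpr ?_
      rintro _ ⟨e, rfl⟩
      exact hL e
    exact hle (h ⟨x, rfl⟩)
  exact hx

/-- Restriction of a lift of an operator to symmetric forms. -/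
noncomputable def restrictOp (h : LinearMap.range (jetIota C E n) ≤ elementalJets C E n) :
    DiffOp C E n F →ₗ[𝕜] (Sym C E n →ₗ[A] F) where
  toFun Δ := (Classical.choose Δ.2).comp (jetIota C E n)
  map_add' Δ Δ' := by
    rw [← LinearMap.add_comp]
    refine lift_iota_unique h _ _ fun e => ?_
    rw [LinearMap.add_apply, ← Classical.choose_spec (Δ + Δ').2 e, ← Classical.choose_spec Δ.2 e,
      ← Classical.choose_spec Δ'.2 e]
    rfl
  map_smul' c Δ := by
    rw [RingHom.id_apply, ← LinearMap.smul_comp]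
    refine lift_iota_unique h _ _ fun e => ?_
    rw [LinearMap.smul_apply, ← Classical.choose_spec (c • Δ).2 e, ← Classical.choose_spec Δ.2 e]
    rfl

theorem restrictOp_eq (h : LinearMap.range (jetIota C E n) ≤ elementalJets C E n)
    (Δ : DiffOp C E n F) (L : Jet C E n →ₗ[A] F) (hL : ∀ e, Δ.1 e = L (jetProl C E n e)) :
    restrictOp C E h Δ = L.comp (jetIota C E n) :=
  lift_iota_unique h _ _ fun e => by rw [← Classical.choose_spec Δ.2 e, hL]

/-- The restriction symbol map `r : Symbⁿ(E, F) → Hom_A(SⁿE, F)`, which sends the symbol of an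
operator `Δ` with lift `L : JⁿE → F` to `L ∘ ιⁿ`. It is defined when `ιⁿ` takes values in elemental
jets. -/
noncomputable def restrictionSymbol
    (h : LinearMap.range (jetIota C E n) ≤ elementalJets C E n) :
    Symb C E n F →ₗ[𝕜] (Sym C E n →ₗ[A] F) :=
  Submodule.liftQ _ (restrictOp C E h) (by
    rintro ⟨Δ, hΔ⟩ hlow
    have hlow' : Δ ∈ DiffOpLower C E F n := hlow
    rw [LinearMap.mem_ker]
    cases n with
    | zero =>
      have h0 : Δ = 0 := hlow'
      rw [restrictOp_eq C E h ⟨Δ, hΔ⟩ 0 (fun e => by simp [h0]), LinearMap.zero_comp]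
    | succ n =>
      obtain ⟨L, hL⟩ := hlow'
      rw [restrictOp_eq C E h ⟨Δ, hΔ⟩ (L.comp (jetProj C E n)) (fun e => by
        rw [LinearMap.comp_apply, jetProj_jetProl]; exact hL e)]
      ext x
      simp [jetProj_jetIota])

theorem restrictionSymbol_symbol (h : LinearMap.range (jetIota C E n) ≤ elementalJets C E n)
    (Δ : DiffOp C E n F) (L : Jet C E n →ₗ[A] F) (hL : ∀ e, Δ.1 e = L (jetProl C E n e)) :
    restrictionSymbol C E h (symbol C E n F Δ) = L.comp (jetIota C E n) :=
  restrictOp_eq C E h Δ L hL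

variable {C E} in
theorem range_iota_le (h : elementalJets C E n = ⊤) :
    LinearMap.range (jetIota C E n) ≤ elementalJets C E n :=
  h ▸ le_top

end Restriction

/-! ### Quantizations -/

/-- A natural `n`-quantization for `E`: a natural transformation
`Symbⁿ(E, -) → Diffⁿ(E, -)` of functors from left `A`-modules to `𝕜`-modules that is a section of
the symbol map. -/
structure NaturalQuantization (n : ℕ) where
  app : ∀ (F : Type v) [AddCommGroup F] [Module 𝕜 F] [Module A F] [IsScalarTower 𝕜 A F],
    Symb C E n F →ₗ[𝕜] DiffOp C E n F
  natural : ∀ (F G : Type v) [AddCommGroup F] [Module 𝕜 F] [Module A F] [IsScalarTower 𝕜 A F]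
    [AddCommGroup G] [Module 𝕜 G] [Module A G] [IsScalarTower 𝕜 A G]
    (φ : F →ₗ[A] G) (σ : Symb C E n F),
    app G (symbMap C E n φ σ) = diffMap C E n φ (app F σ)
  isSection : ∀ (F : Type v) [AddCommGroup F] [Module 𝕜 F] [Module A F] [IsScalarTower 𝕜 A F]
    (σ : Symb C E n F), symbol C E n F (app F σ) = σ

/-- A natural full quantization for `E`: the natural transformation
`⨁ₙ Symbⁿ(E, -) → Diff(E, -)` that is the sum of a collection of natural `n`-quantizations. -/
structure NaturalFullQuantization where
  app : ∀ (F : Type v) [AddCommGroup F] [Module 𝕜 F] [Module A F] [IsScalarTower 𝕜 A F],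
    SymbAll C E F →ₗ[𝕜] DiffOpFin C E F
  natural : ∀ (F G : Type v) [AddCommGroup F] [Module 𝕜 F] [Module A F] [IsScalarTower 𝕜 A F]
    [AddCommGroup G] [Module 𝕜 G] [Module A G] [IsScalarTower 𝕜 A G]
    (φ : F →ₗ[A] G) (σ : SymbAll C E F),
    app G (symbAllMap C E φ σ) = diffFinMap C E φ (app F σ)
  component : ∀ n : ℕ, NaturalQuantization.{u, v} C E n
  app_eq_sum : ∀ (F : Type v) [AddCommGroup F] [Module 𝕜 F] [Module A F] [IsScalarTower 𝕜 A F],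
    app F = DirectSum.toModule 𝕜 ℕ (DiffOpFin C E F)
      (fun n => (toFin C E n F).comp ((component n).app F))

/-! ### Connections and the iterated operator -/

/-- A (left) connection on the left `A`-module `M`. -/
structure Connection (M : Type u) [AddCommGroup M] [Module 𝕜 M] [Module A M]
    [IsScalarTower 𝕜 A M] where
  toMap : M →ₗ[𝕜] FormTensor C 1 M
  leibniz : ∀ (a : A) (m : M), toMap (a • m) = ft C (dA C a) m + a • toMap m

/-- A left splitting in left `A`-modules (a retraction) of `Sᵏ⁺¹E → Ω¹ ⊗_A SᵏE`. -/
structure Retraction (k : ℕ) where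
  toMap : FormTensor C 1 (Sym C E k) →ₗ[A] Sym C E (k + 1)
  leftInverse : ∀ x : Sym C E (k + 1), toMap (symIncl C E k x) = x

variable {C E} in
/-- The operator `s^{n-1} ∘ ∇^{n-1} ∘ ⋯ ∘ s¹ ∘ ∇¹ ∘ s⁰ ∘ ∇⁰ : E → SⁿE`. Here `s⁰` is the
identity of `Ω¹ ⊗_A E`, being a retraction of the identity. -/
def iteratedOp : (n : ℕ) → (∀ k < n, Connection C (Sym C E k)) → (∀ k < n, Retraction C E k) →
    (E →ₗ[𝕜] Sym C E n)
  | 0, _, _ => LinearMap.id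
  | n + 1, c, s =>
    ((s n n.lt_succ_self).toMap.restrictScalars 𝕜).comp
      ((c n n.lt_succ_self).toMap.comp
        (iteratedOp n (fun k hk => c k (hk.trans n.lt_succ_self))
          (fun k hk => s k (hk.trans n.lt_succ_self))))

end

end NCJet

/-! A connection on `M` is the same thing as an `A`-linear retraction of `ι : Ω¹M → J¹M`. The
Leibniz rule says exactly that `[a ⊗ m] ↦ a ∇m` is well defined on `J¹M`, and that this map is the
identity on `Ω¹M` (`Connection.lift`, `Connection.lift_iota`).

Composing such maps order by order with the retractions of `Sᵏ⁺¹E → Ω¹SᵏE` gives an `A`-linear map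
`Pₙ : JⁿE → SⁿE`, called `iteratedLift`. It has two properties. First, `Pₙ ∘ jⁿ` is the iterated
operator (`iteratedLift_jetProl`), so that operator has order at most `n`. Second, `Pₙ ∘ ιⁿ = id`
(`iteratedLift_jetIota`), so its restriction symbol is the identity of `SⁿE`.

Now let `σ` be the symbol of `Δ = L ∘ jⁿ`. The proposed quantization of `σ` is `L ∘ ιⁿ ∘ Pₙ ∘ jⁿ`,
and it differs from `Δ` by the operator with lift `L ∘ ιⁿ ∘ Pₙ - L`. This lift vanishes on the image
of `ιⁿ` by the second property. By right exactness that image is the kernel of `JⁿE → Jⁿ⁻¹E` and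
this projection is onto, so the lift factors through `Jⁿ⁻¹E`. The difference therefore has order at
most `n - 1`, and the symbol of the quantization is again `σ` (`symbol_quantize`).

Naturality in `F` holds because everything depends on `F` only through composition on the left with
`L`. The full quantization is then the map out of the direct sum with the given components. -/

namespace NCJet

section

variable {𝕜 : Type w} {A Ω : Type u} [CommRing 𝕜] [Ring A] [Algebra 𝕜 A] [Ring Ω] [Algebra 𝕜 Ω]
variable {C : ExteriorCalculus 𝕜 A Ω}

/-! ### Connections as `A`-linear retractions of `Ω¹M → J¹M` -/

section Lift

variable {M : Type u} [AddCommGroup M] [Module 𝕜 M] [Module A M] [IsScalarTower 𝕜 A M]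

/-- The `A`-linear map `J¹M → Ω¹ ⊗_A M` through which a connection on `M` factors. -/
def Connection.lift (c : Connection C M) : OneJet C M →ₗ[A] FormTensor C 1 M :=
  jetLiftA C c.toMap (fun t ht m =>
    -- By Leibniz, `a ∇(b m) = (a b) ∇m + a db ⊗ m`, a function of `a b` plus a function of `a db`.
    -- Both parts vanish when summed over an element of `N`.
    vanish_on_jetRel C _ m
      ((LinearMap.toSpanSingleton A (FormTensor C 1 M) (c.toMap m)).restrictScalars 𝕜)
      ((ftHom C).flip m)
      (fun a b => by
        simp only [extendMap_apply, c.leibniz, smul_add, left_smul_ft, LinearMap.flip_apply,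
          ftHom_apply, LinearMap.restrictScalars_apply, LinearMap.toSpanSingleton_apply, mul_smul]
        abel) t ht)

@[simp] theorem Connection.lift_prol (c : Connection C M) (m : M) :
    c.lift (prol C m) = c.toMap m :=
  jetLiftA_prol C _ _ m

/-- The lift of a connection splits the inclusion of `Ω¹ ⊗_A M` into `J¹M`. -/
@[simp] theorem Connection.lift_iota (c : Connection C M) (x : FormTensor C 1 M) :
    c.lift (iota C M x) = x := by
  induction x using ft_one_induction with
  | h a b m =>
    -- On a generator `a db ⊗ m` the value is `a ∇(b m) - (a b) ∇m`, and Leibniz leaves only `a db ⊗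
    -- m`.
    rw [iota_adb, map_sub, map_smul c.lift, map_smul c.lift, lift_prol, lift_prol, c.leibniz,
      smul_add, mul_smul, left_smul_ft, add_sub_cancel_right]
  | h0 => simp
  | hadd x y hx hy => simp only [map_add, hx, hy]

/-- Functoriality of `Ωᵏ ⊗_A -`. It turns a retraction of `ιⁿ` into a retraction of `Ω¹ ⊗ ιⁿ`, which
the induction in `iteratedLift_jetIota` needs. -/
theorem ftMap_comp_eq_id {M' : Type u} [AddCommGroup M'] [Module 𝕜 M'] [Module A M']
    [IsScalarTower 𝕜 A M'] {k : ℕ} {f : M →ₗ[A] M'} {g : M' →ₗ[A] M}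
    (h : ∀ m, g (f m) = m) (x : FormTensor C k M) : ftMap C k g (ftMap C k f x) = x := by
  induction x using ft_induction with
  | h ω m => simp [h]
  | h0 => simp
  | hadd x y hx hy => simp only [map_add, hx, hy]

end Lift

/-! ### The `A`-linear lift of the iterated operator -/

variable {E : Type u} [AddCommGroup E] [Module 𝕜 E] [Module A E] [IsScalarTower 𝕜 A E]

/-- The `A`-linear map `JⁿE → SⁿE` through which the iterated operator factors. -/
def iteratedLift : (n : ℕ) → (∀ k < n, Connection C (Sym C E k)) → (∀ k < n, Retraction C E k) →
    (Jet C E n →ₗ[A] Sym C E n)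
  | 0, _, _ => LinearMap.id
  | n + 1, c, s =>
    -- The composite is `Jⁿ⁺¹E → J¹JⁿE → J¹SⁿE → Ω¹SⁿE → Sⁿ⁺¹E`. The previous lift is applied under
    -- `J¹`, so that only a connection on `SⁿE` is required, not one on `JⁿE`.
    (s n n.lt_succ_self).toMap.comp ((c n n.lt_succ_self).lift.comp
      ((jetMap C (iteratedLift n (fun k hk => c k (hk.trans n.lt_succ_self))
        (fun k hk => s k (hk.trans n.lt_succ_self)))).comp (jetIncl C E n)))

/-- In `J¹JⁿE` the prolongation `jⁿ⁺¹ e` is `j¹(jⁿ e)`. The functor `J¹` carries `j¹` to `j¹`, and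
the lift of a connection turns `j¹` into `∇`. Hence the iterated operator has order at most `n`. -/
theorem iteratedLift_jetProl (n : ℕ) (c : ∀ k < n, Connection C (Sym C E k))
    (s : ∀ k < n, Retraction C E k) (e : E) :
    iteratedLift n c s (jetProl C E n e) = iteratedOp n c s e := by
  induction n with
  | zero => rfl
  | succ n ih =>
    rw [iteratedLift, iteratedOp]
    simp only [LinearMap.comp_apply, LinearMap.restrictScalars_apply]
    rw [jetIncl_jetProl, jetMap_prol, ih, Connection.lift_prol]

/-- The lift of the iterated operator is a retraction of `ιⁿ`. -/
theorem iteratedLift_jetIota (n : ℕ) (c : ∀ k < n, Connection C (Sym C E k))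
    (s : ∀ k < n, Retraction C E k) (x : Sym C E n) :
    iteratedLift n c s (jetIota C E n x) = x := by
  induction n with
  | zero => rfl
  | succ n ih =>
    rw [iteratedLift]
    simp only [LinearMap.comp_apply]
    -- Inside `J¹JⁿE`, `ιⁿ⁺¹` is `ι ∘ (Ω¹ ⊗ ιⁿ) ∘ ι_∧`. Naturality of `ι` moves `Pₙ` from `J¹` to
    -- `Ω¹`. Then the connection cancels `ι`, the induction hypothesis cancels `ιⁿ`, and the
    -- retraction cancels `ι_∧`.
    rw [jetIncl_jetIota, iota_natural, Connection.lift_iota, ftMap_comp_eq_id (ih _ _),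
      Retraction.leftInverse]

/-! ### Quantization at a fixed target module -/

section Symbols

variable {n : ℕ}
variable {F : Type v} [AddCommGroup F] [Module 𝕜 F] [Module A F] [IsScalarTower 𝕜 A F]
variable {G : Type v} [AddCommGroup G] [Module 𝕜 G] [Module A G] [IsScalarTower 𝕜 A G]

theorem symbol_surjective : Function.Surjective (symbol C E n F) :=
  Submodule.mkQ_surjective _

/-- If `L` lifts `Δ`, then `φ ∘ L` lifts `φ ∘ Δ`, and composing with `ιⁿ` on the right commutes with
composing with `φ` on the left. This is the source of naturality of the quantization. -/
theorem restrictionSymbol_symbMap (h : LinearMap.range (jetIota C E n) ≤ elementalJets C E n)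
    (φ : F →ₗ[A] G) (σ : Symb C E n F) :
    restrictionSymbol C E h (symbMap C E n φ σ) = φ.comp (restrictionSymbol C E h σ) := by
  obtain ⟨Δ, rfl⟩ := symbol_surjective σ
  obtain ⟨L, hL⟩ := Δ.2
  have h1 : symbMap C E n φ (symbol C E n F Δ) = symbol C E n G (diffMap C E n φ Δ) := rfl
  rw [h1, restrictionSymbol_symbol C E h Δ L hL,
    restrictionSymbol_symbol C E h _ (φ.comp L) (fun e => congrArg φ (hL e))]
  rfl

/-- If the jet sequence is right exact, an `A`-linear map on `JⁿE` that vanishes on symmetric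
forms represents an operator of order at most `n - 1`. -/
theorem mem_diffOpLower_of_comp_jetIota_eq_zero (hE : JetRightExact C E n) (Δ : E →ₗ[𝕜] F)
    (L : Jet C E n →ₗ[A] F) (hL : ∀ e, Δ e = L (jetProl C E n e))
    (h0 : ∀ x, L (jetIota C E n x) = 0) : Δ ∈ DiffOpLower C E F n := by
  cases n with
  | zero =>
    -- Only the zero operator has order at most `-1`. Since `ι⁰` is onto, `L` itself is zero.
    change Δ = 0
    ext e
    obtain ⟨x, hx⟩ := hE (jetProl C E 0 e)
    rw [hL, ← hx, h0, LinearMap.zero_apply]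
  | succ n =>
    obtain ⟨hex, hsurj⟩ := hE
    -- By exactness this kernel is the image of `ιⁿ⁺¹`, where `L` vanishes. So `L` descends to the
    -- quotient, which surjectivity of the projection identifies with `JⁿE`.
    have hker : LinearMap.ker (jetProj C E n) ≤ LinearMap.ker L := by
      intro y hy
      obtain ⟨x, rfl⟩ := (hex y).mp hy
      exact h0 x
    refine ⟨((LinearMap.ker (jetProj C E n)).liftQ L hker).comp
      ((jetProj C E n).quotKerEquivOfSurjective hsurj).symm.toLinearMap, fun e => ?_⟩
    -- The class of `jⁿ⁺¹ e` corresponds to `jⁿ e` because the projection sends one prolongation to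
    -- the other. Hence the descended map is a lift of `Δ` to `JⁿE`.
    have h2 : ((jetProj C E n).quotKerEquivOfSurjective hsurj).symm (jetProl C E n e) =
        Submodule.Quotient.mk (jetProl C E (n + 1) e) := by
      rw [LinearEquiv.symm_apply_eq, ← jetProj_jetProl]
      rfl
    rw [hL, LinearMap.comp_apply, LinearEquiv.coe_coe, h2, Submodule.liftQ_apply]

/-- Composition of the restriction symbol with the iterated operator. -/
noncomputable def quantize (hJ : LinearMap.range (jetIota C E n) ≤ elementalJets C E n)
    (c : ∀ k < n, Connection C (Sym C E k)) (s : ∀ k < n, Retraction C E k) :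
    Symb C E n F →ₗ[𝕜] DiffOp C E n F where
  toFun σ := ⟨((restrictionSymbol C E hJ σ).restrictScalars 𝕜).comp (iteratedOp n c s),
    -- The `A`-linear map on `JⁿE` that witnesses order at most `n`.
    (restrictionSymbol C E hJ σ).comp (iteratedLift n c s), fun e => by
      simp [iteratedLift_jetProl]⟩
  map_add' σ τ := by ext e; simp
  map_smul' a σ := by ext e; simp

theorem quantize_apply (hJ : LinearMap.range (jetIota C E n) ≤ elementalJets C E n)
    (c : ∀ k < n, Connection C (Sym C E k)) (s : ∀ k < n, Retraction C E k)
    (σ : Symb C E n F) (e : E) :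
    (quantize hJ c s σ : E →ₗ[𝕜] F) e = restrictionSymbol C E hJ σ (iteratedOp n c s e) :=
  rfl

/-- A representative `Δ` of `σ` and its quantization have lifts that agree on symmetric forms,
because `iteratedLift` is a retraction of `ιⁿ`. Right exactness then makes their difference of order
at most `n - 1`. -/
theorem symbol_quantize (hJ : LinearMap.range (jetIota C E n) ≤ elementalJets C E n)
    (hE : JetRightExact C E n) (c : ∀ k < n, Connection C (Sym C E k))
    (s : ∀ k < n, Retraction C E k) (σ : Symb C E n F) :
    symbol C E n F (quantize hJ c s σ) = σ := by
  obtain ⟨Δ, rfl⟩ := symbol_surjective σ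
  obtain ⟨L, hL⟩ := Δ.2
  refine (Submodule.Quotient.eq _).mpr ?_
  refine mem_diffOpLower_of_comp_jetIota_eq_zero hE _
    -- The lift of the difference, `L ∘ ιⁿ ∘ Pₙ - L`. On `ιⁿ x` it gives `L (ιⁿ x) - L (ιⁿ x)`.
    ((L.comp (jetIota C E n)).comp (iteratedLift n c s) - L) (fun e => ?_) (fun x => ?_)
  · change (quantize hJ c s (symbol C E n F Δ) : E →ₗ[𝕜] F) e - Δ.1 e = _
    rw [quantize_apply, restrictionSymbol_symbol C E hJ Δ L hL, hL, LinearMap.sub_apply,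
      LinearMap.comp_apply (L.comp _), iteratedLift_jetProl]
  · rw [LinearMap.sub_apply, LinearMap.comp_apply, LinearMap.comp_apply, iteratedLift_jetIota,
      sub_self]

end Symbols

/-! ### Natural quantizations and their direct sum -/

/-- The natural `n`-quantization given by connections and retractions of all orders below `n`. -/
noncomputable def NaturalQuantization.ofConnections {n : ℕ}
    (hJ : LinearMap.range (jetIota C E n) ≤ elementalJets C E n)
    (hE : JetRightExact C E n) (c : ∀ k < n, Connection C (Sym C E k))
    (s : ∀ k < n, Retraction C E k) : NaturalQuantization.{u, v} C E n where
  app F _ _ _ _ := quantize hJ c s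
  natural F G _ _ _ _ _ _ _ _ φ σ := by
    ext e
    rw [quantize_apply, restrictionSymbol_symbMap]
    rfl
  isSection F _ _ _ _ σ := symbol_quantize hJ hE c s σ

/-- The full quantization with given components. -/
noncomputable def NaturalFullQuantization.ofComponents
    (q : ∀ n, NaturalQuantization.{u, v} C E n) : NaturalFullQuantization.{u, v} C E where
  app F _ _ _ _ := DirectSum.toModule 𝕜 ℕ (DiffOpFin C E F)
    (fun n => (toFin C E n F).comp ((q n).app F))
  natural F G _ _ _ _ _ _ _ _ φ σ := by
    suffices h : (DirectSum.toModule 𝕜 ℕ (DiffOpFin C E G)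
          (fun n => (toFin C E n G).comp ((q n).app G))).comp (symbAllMap C E φ) =
        (diffFinMap C E φ).comp (DirectSum.toModule 𝕜 ℕ (DiffOpFin C E F)
          (fun n => (toFin C E n F).comp ((q n).app F))) from LinearMap.congr_fun h σ
    -- Maps out of a direct sum are determined on the summands, and on the `n`-th summand the claim
    -- is naturality of `q n`.
    refine DirectSum.linearMap_ext 𝕜 fun n => LinearMap.ext fun τ => ?_
    simp only [LinearMap.comp_apply, symbAllMap, DirectSum.lmap_lof, DirectSum.toModule_lof,
      (q n).natural]
    rfl
  component := q
  app_eq_sum F _ _ _ _ := rfl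

end

end NCJet

open NCJet in
theorem corollary5p11 {𝕜 : Type w} {A Ω : Type u} [CommRing 𝕜] [Ring A] [Algebra 𝕜 A]
    [Ring Ω] [Algebra 𝕜 Ω] (C : ExteriorCalculus 𝕜 A Ω)
    (E : Type u) [AddCommGroup E] [Module 𝕜 E] [Module A E] [IsScalarTower 𝕜 A E] :
    (∀ (n : ℕ) (hJ : elementalJets C E n = ⊤) (_ : JetRightExact C E n)
        (c : ∀ k < n, Connection C (Sym C E k)) (s : ∀ k < n, Retraction C E k),
      ∃ q : NaturalQuantization.{u, v} C E n,
        ∀ (F : Type v) [AddCommGroup F] [Module 𝕜 F] [Module A F] [IsScalarTower 𝕜 A F]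
          (σ : Symb C E n F) (e : E),
          (q.app F σ : E →ₗ[𝕜] F) e =
            restrictionSymbol C E (range_iota_le hJ) σ (iteratedOp n c s e)) ∧
    (∀ (hJ : ∀ n, elementalJets C E n = ⊤) (_ : ∀ n, JetRightExact C E n)
        (c : ∀ k, Connection C (Sym C E k)) (s : ∀ k, Retraction C E k),
      ∃ q : NaturalFullQuantization.{u, v} C E,
        ∀ (n : ℕ) (F : Type v) [AddCommGroup F] [Module 𝕜 F] [Module A F] [IsScalarTower 𝕜 A F]
          (σ : Symb C E n F) (e : E),
          ((q.component n).app F σ : E →ₗ[𝕜] F) e =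
            restrictionSymbol C E (range_iota_le (hJ n)) σ
              (iteratedOp n (fun k _ => c k) (fun k _ => s k) e)) := by
  -- Both formulas hold by definition of `quantize`. In the second part each order `n` uses the same
  -- families of connections and retractions, restricted to `k < n`.
  refine ⟨fun n hJ hE c s =>
    ⟨NaturalQuantization.ofConnections (range_iota_le hJ) hE c s, fun F _ _ _ _ σ e => rfl⟩,
    fun hJ hE c s =>
    ⟨NaturalFullQuantization.ofComponents fun n =>
      NaturalQuantization.ofConnections (range_iota_le (hJ n)) (hE n) (fun k _ => c k)
        (fun k _ => s k), fun n F _ _ _ _ σ e => rfl⟩⟩
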